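/- Let $R$ be a commutative domain with field of quotients $F$, and let $A\in R^{n\times n}$ have rank $r$ (over $F$). For a matrix $S\in F^{n\times n}$ with at most one nonzero entry in each row and in each column, let $\bar S$ be the $0/1$ matrix that has the unit matrix in the block at the intersection of the zero rows and the zero columns of $S$ and zeros elsewhere; let $E$ be obtained from $S$ by replacing each nonzero entry by $1$; and put $\bar I=\mathbf I-EE^{T}$, $\bar J=\mathbf I-E^{T}E$. An LSU factorization of $A$ consists of nested nonzero minors $\det_1,\dots,\det_r$ of $A$ of sizes $1,\dots,r$ (with $\det_0=1$), a lower triangular $L\in R^{n\times n}$, an upper triangular $U\in R^{n\times n}$, matrices $M,W\in R^{n\times n}$, and a matrix $S\in F^{n\times n}$ with at most one nonzero entry in each row and column, whose nonzero entries are exactly $r$ in number and equal to $(\det_{k-1}\det_k)^{-1}$, $k=1,\dots,r$, such that $$LSU=A,\qquad L\widehat S M=\mathbf I,\qquad W\widehat S U=\mathbf I,\qquad \widehat S=\tfrac1{\det_r}(S+\bar S),\qquad L\bar I=\bar I,\qquad \bar J U=\bar J .$$ Given any LSU factorization of $A$, put $$P=\frac1{\det_r^{2}}\,W S M\in F^{n\times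 n}.$$ (a) If $A$ is invertible over $F$, then $AP=PA=\mathbf I$, that is, $P=A^{-1}$. (b) Whether or not $A$ is invertible, $APA=A$ and $PAP=P$. (c) In general $P$ is not the Moore–Penrose inverse of $A$: over every $R$ and for every $n\ge 2$ there is a singular $A\in R^{n\times n}$ that has an LSU factorization and for which, whatever LSU factorization is used, $(PA)^T\ne PA$ and $(AP)^T\ne AP$, so that $P$ is not the Moore–Penrose generalized inverse of $A$ (defined by $APA=A$, $PAP=P$, $(PA)^T=PA$, $(AP)^T=AP$). -/

import Mathlib

namespace LSU

/-- The weighted permutation semigroup: at most one nonzero entry in each row and in each column. -/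
def IsWeightedPermutation {n : ℕ} {F : Type*} [Field F] (S : Matrix (Fin n) (Fin n) F) : Prop :=
  (∀ i j j', S i j ≠ 0 → S i j' ≠ 0 → j = j') ∧ (∀ i i' j, S i j ≠ 0 → S i' j ≠ 0 → i = i')

open Classical in
/-- The unit mapping `S ↦ S^{→1}`: every nonzero entry is replaced by `1`. -/
noncomputable def unitMap {n : ℕ} {F : Type*} [Field F] (S : Matrix (Fin n) (Fin n) F) :
    Matrix (Fin n) (Fin n) F :=
  Matrix.of fun i j => if S i j = 0 then 0 else 1

/-- Row `i` of `S` is zero. -/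
def ZeroRow {n : ℕ} {F : Type*} [Field F] (S : Matrix (Fin n) (Fin n) F) (i : Fin n) : Prop :=
  ∀ j, S i j = 0

/-- Column `j` of `S` is zero. -/
def ZeroCol {n : ℕ} {F : Type*} [Field F] (S : Matrix (Fin n) (Fin n) F) (j : Fin n) : Prop :=
  ∀ i, S i j = 0

open Classical in
/-- The complementary matrix `S̄`: the block at the intersection of the zero rows and the zero
columns of `S` is the unit matrix (the `k`-th zero row meets the `k`-th zero column in a `1`), and
all other entries are `0`. -/
noncomputable def compl {n : ℕ} {F : Type*} [Field F] (S : Matrix (Fin n) (Fin n) F) :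
    Matrix (Fin n) (Fin n) F :=
  Matrix.of fun i j =>
    if ZeroRow S i ∧ ZeroCol S j ∧
        {i' | i' < i ∧ ZeroRow S i'}.ncard = {j' | j' < j ∧ ZeroCol S j'}.ncard
    then 1 else 0

/-- The extended mapping `S ↦ S^{Ext}`: the block of `S` at the intersection of its zero rows and
zero columns is replaced by a unit block. -/
noncomputable def ext {n : ℕ} {F : Type*} [Field F] (S : Matrix (Fin n) (Fin n) F) :
    Matrix (Fin n) (Fin n) F :=
  S + compl S

/-- `Ŝ = (1 / δ) S^{Ext}`. -/
noncomputable def hat {n : ℕ} {F : Type*} [Field F] (S : Matrix (Fin n) (Fin n) F) (δ : F) :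
    Matrix (Fin n) (Fin n) F :=
  (1 / δ) • ext S

/-- `d 1, …, d r` are nested nondegenerate minors of `A`, of sizes `1, …, r`, and `d 0 = 1` is the
empty minor. The rows and columns of each submatrix may be listed in any order, so that no sign
convention is imposed. -/
def IsNestedMinors {n r : ℕ} {R : Type*} [CommRing R] (A : Matrix (Fin n) (Fin n) R)
    (d : Fin (r + 1) → R) : Prop :=
  ∃ rows cols : (k : Fin (r + 1)) → Fin (k : ℕ) → Fin n,
    (∀ k, Function.Injective (rows k) ∧ Function.Injective (cols k)) ∧
    (∀ k l, k ≤ l →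
      Set.range (rows k) ⊆ Set.range (rows l) ∧ Set.range (cols k) ⊆ Set.range (cols l)) ∧
    ∀ k, d k = (A.submatrix (rows k) (cols k)).det ∧ d k ≠ 0

/-- `(L, S, U, M, W)`, with the sequence of minors `d 0 = 1, d 1, …, d r`, is an LSU factorization
of the matrix `A` over the domain `R` with field of quotients `F`. (That `L`, `U`, `M`, `W` have
rank `n` and `S` has rank `r` follows.) -/
structure IsLSUFactorization {n r : ℕ} {R F : Type*} [CommRing R] [IsDomain R] [Field F]
    [Algebra R F] [IsFractionRing R F] (A L U M W : Matrix (Fin n) (Fin n) R)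
    (S : Matrix (Fin n) (Fin n) F) (d : Fin (r + 1) → R) : Prop where
  rank_eq : (A.map (algebraMap R F)).rank = r
  minors : IsNestedMinors A d
  lower : L.BlockTriangular OrderDual.toDual
  upper : U.BlockTriangular id
  weightedPerm : IsWeightedPermutation S
  /-- `S` has exactly `r` nonzero entries, with the values `(d (k - 1) * d k)⁻¹`, `k = 1, …, r`. -/
  entries : ∃ e : Fin r → Fin n × Fin n, Function.Injective e ∧
    (∀ i j, S i j ≠ 0 ↔ (i, j) ∈ Set.range e) ∧
    ∀ k : Fin r, S (e k).1 (e k).2 = (algebraMap R F (d k.castSucc * d k.succ))⁻¹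
  /-- `L S U = A`. -/
  factor : L.map (algebraMap R F) * S * U.map (algebraMap R F) = A.map (algebraMap R F)
  /-- `L Ŝ M = 𝐈`. -/
  left_inv : L.map (algebraMap R F) * hat S (algebraMap R F (d (Fin.last r))) *
    M.map (algebraMap R F) = 1
  /-- `W Ŝ U = 𝐈`. -/
  right_inv : W.map (algebraMap R F) * hat S (algebraMap R F (d (Fin.last r))) *
    U.map (algebraMap R F) = 1
  /-- `L Ī = Ī`, where `Ī = 𝐈 - E Eᵀ` and `E = S^{→1}`. -/
  lower_compl : L.map (algebraMap R F) * (1 - unitMap S * (unitMap S).transpose) =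
    1 - unitMap S * (unitMap S).transpose
  /-- `J̄ U = J̄`, where `J̄ = 𝐈 - Eᵀ E` and `E = S^{→1}`. -/
  upper_compl : (1 - (unitMap S).transpose * unitMap S) * U.map (algebraMap R F) =
    1 - (unitMap S).transpose * unitMap S

/-- `P = (1 / δ²) W S M`. -/
noncomputable def pinv {n : ℕ} {R F : Type*} [CommRing R] [Field F] [Algebra R F]
    (W : Matrix (Fin n) (Fin n) R) (S : Matrix (Fin n) (Fin n) F) (M : Matrix (Fin n) (Fin n) R)
    (δ : R) : Matrix (Fin n) (Fin n) F :=
  (1 / (algebraMap R F δ) ^ 2) • (W.map (algebraMap R F) * S * M.map (algebraMap R F))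

/-- `P` is the Moore–Penrose generalized inverse of `A` (with respect to transposition). -/
def IsMoorePenroseInverse {n : ℕ} {F : Type*} [Field F] (A P : Matrix (Fin n) (Fin n) F) : Prop :=
  A * P * A = A ∧ P * A * P = P ∧ (P * A).transpose = P * A ∧ (A * P).transpose = A * P

end LSU

namespace LSU

open Matrix

section WeightedPermutation

variable {n : ℕ} {F : Type*} [Field F] {S : Matrix (Fin n) (Fin n) F}

theorem IsWeightedPermutation.transpose (hS : IsWeightedPermutation S) :
    IsWeightedPermutation Sᵀ :=
  ⟨fun i j j' h h' => hS.2 j j' i h h', fun i i' j h h' => hS.1 j i i' h h'⟩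

open Classical in
theorem unitMap_mul_transpose (hS : IsWeightedPermutation S) :
    unitMap S * (unitMap S)ᵀ = diagonal fun i => if ZeroRow S i then 0 else 1 := by
  ext i i'
  rw [mul_apply, diagonal_apply]
  simp only [unitMap, of_apply, transpose_apply]
  by_cases h : ZeroRow S i
  · simp [h, h _]
  · obtain ⟨j, hj⟩ := not_forall.1 h
    rw [Finset.sum_eq_single j]
    · by_cases hi : i = i'
      · subst hi
        simp [h, hj]
      · have : S i' j = 0 := by
          by_contra h'
          exact hi (hS.2 i i' j hj h')
        simp [hi, this]
    · intro j' _ hne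
      have : S i j' = 0 := by
        by_contra h'
        exact hne (hS.1 i j' j h' hj)
      simp [this]
    · simp

open Classical in
theorem unitMap_transpose_mul (hS : IsWeightedPermutation S) :
    (unitMap S)ᵀ * unitMap S = diagonal fun j => if ZeroCol S j then 0 else 1 :=
  unitMap_mul_transpose hS.transpose

theorem unitMap_mul_transpose_mul (hS : IsWeightedPermutation S) :
    unitMap S * (unitMap S)ᵀ * S = S := by
  ext i j
  rw [unitMap_mul_transpose hS, diagonal_mul]
  by_cases h : ZeroRow S i
  · simp [h, h j]
  · simp [h]

/-- `E Eᵀ` projects `S^{Ext}` to `S`. -/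
theorem unitMap_mul_transpose_mul_ext (hS : IsWeightedPermutation S) :
    unitMap S * (unitMap S)ᵀ * ext S = S := by
  ext i j
  rw [unitMap_mul_transpose hS, diagonal_mul]
  by_cases h : ZeroRow S i
  · simp [h, h j]
  · simp [h, ext, compl]

/-- `Eᵀ E` projects `S^{Ext}` to `S`. -/
theorem ext_mul_unitMap_transpose_mul (hS : IsWeightedPermutation S) :
    ext S * ((unitMap S)ᵀ * unitMap S) = S := by
  ext i j
  rw [unitMap_transpose_mul hS, mul_diagonal]
  by_cases h : ZeroCol S j
  · simp [h, h i]
  · simp [h, ext, compl]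

end WeightedPermutation

section Pseudoinverse

variable {n r : ℕ} {R F : Type*} [CommRing R] [IsDomain R] [Field F] [Algebra R F]
  [IsFractionRing R F] {A L U M W : Matrix (Fin n) (Fin n) R} {S : Matrix (Fin n) (Fin n) F}
  {d : Fin (r + 1) → R}

theorem IsLSUFactorization.algebraMap_last_ne_zero (h : IsLSUFactorization A L U M W S d) :
    algebraMap R F (d (Fin.last r)) ≠ 0 := by
  obtain ⟨rows, cols, -, -, hd⟩ := h.minors
  exact (map_ne_zero_iff _ (IsFractionRing.injective R F)).2 (hd _).2

theorem IsLSUFactorization.isUnit_lower (h : IsLSUFactorization A L U M W S d) :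
    IsUnit (L.map (algebraMap R F)) := by
  have hl := h.left_inv
  rw [Matrix.mul_assoc] at hl
  exact IsUnit.of_mul_eq_one _ hl

theorem IsLSUFactorization.isUnit_upper (h : IsLSUFactorization A L U M W S d) :
    IsUnit (U.map (algebraMap R F)) :=
  IsUnit.of_mul_eq_one _ (mul_eq_one_comm.1 h.right_inv)

/-- In terms of the inverse `Y` of `S^{Ext}`, `U P L = Y S Y`. -/
theorem IsLSUFactorization.exists_inverse_ext (h : IsLSUFactorization A L U M W S d) :
    ∃ Y : Matrix (Fin n) (Fin n) F, S * Y = unitMap S * (unitMap S)ᵀ ∧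
      Y * S = (unitMap S)ᵀ * unitMap S ∧ S * Y * S = S ∧
      U.map (algebraMap R F) * pinv W S M (d (Fin.last r)) * L.map (algebraMap R F) =
        Y * S * Y := by
  have hδ := h.algebraMap_last_ne_zero
  have hl := h.left_inv
  have hr := h.right_inv
  have hS := h.weightedPerm
  rw [pinv]
  set δ := algebraMap R F (d (Fin.last r))
  set L' := L.map (algebraMap R F)
  set U' := U.map (algebraMap R F)
  set M' := M.map (algebraMap R F)
  set W' := W.map (algebraMap R F)
  have h1 : U' * W' * hat S δ = 1 := by
    rw [Matrix.mul_assoc]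
    exact mul_eq_one_comm.1 (by rwa [Matrix.mul_assoc] at hr ⊢)
  have h2 : hat S δ * (M' * L') = 1 := by
    rw [← Matrix.mul_assoc]
    rw [Matrix.mul_assoc] at hl
    exact mul_eq_one_comm.1 hl
  have h3 : U' * W' = M' * L' := left_inv_eq_right_inv h1 h2
  have hYX : (δ⁻¹ • (U' * W')) * ext S = 1 := by
    rw [← h1, hat, one_div, Matrix.mul_smul, Matrix.smul_mul]
  have hXY := mul_eq_one_comm.1 hYX
  have hUW : U' * W' = δ • δ⁻¹ • (U' * W') := (smul_inv_smul₀ hδ _).symm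
  have hML : M' * L' = δ • δ⁻¹ • (U' * W') := h3 ▸ hUW
  generalize δ⁻¹ • (U' * W') = Y at *
  have hSY : S * Y = unitMap S * (unitMap S)ᵀ := by
    conv_lhs => rw [← unitMap_mul_transpose_mul_ext hS]
    rw [Matrix.mul_assoc, hXY, Matrix.mul_one]
  refine ⟨Y, hSY, ?_, ?_, ?_⟩
  · conv_lhs => rw [← ext_mul_unitMap_transpose_mul hS]
    rw [← Matrix.mul_assoc, hYX, Matrix.one_mul]
  · rw [hSY, unitMap_mul_transpose_mul hS]
  · calc _ = (1 / δ ^ 2) • (U' * W' * S * (M' * L')) := by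
          simp only [Matrix.mul_assoc, Matrix.mul_smul, Matrix.smul_mul]
      _ = (1 / δ ^ 2 * (δ * δ)) • (Y * S * Y) := by
          rw [hUW, hML]
          simp only [Matrix.mul_smul, Matrix.smul_mul, smul_smul, mul_assoc]
      _ = _ := by rw [← sq, one_div_mul_cancel (pow_ne_zero 2 hδ), one_smul]

/-- `U (P A) = Eᵀ E U`. -/
theorem IsLSUFactorization.upper_mul_pinv_mul (h : IsLSUFactorization A L U M W S d) :
    U.map (algebraMap R F) * (pinv W S M (d (Fin.last r)) * A.map (algebraMap R F)) =
      (unitMap S)ᵀ * unitMap S * U.map (algebraMap R F) := by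
  obtain ⟨Y, -, hYS, hSYS, hP⟩ := h.exists_inverse_ext
  rw [← h.factor, ← hYS]
  simp only [← Matrix.mul_assoc]
  rw [hP, Matrix.mul_assoc _ Y, Matrix.mul_assoc Y S, ← Matrix.mul_assoc S, hSYS]

/-- `(A P) L = L E Eᵀ`. -/
theorem IsLSUFactorization.mul_pinv_mul_lower (h : IsLSUFactorization A L U M W S d) :
    A.map (algebraMap R F) * pinv W S M (d (Fin.last r)) * L.map (algebraMap R F) =
      L.map (algebraMap R F) * (unitMap S * (unitMap S)ᵀ) := by
  obtain ⟨Y, hSY, -, hSYS, hP⟩ := h.exists_inverse_ext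
  rw [← h.factor, ← hSY, Matrix.mul_assoc, Matrix.mul_assoc, ← Matrix.mul_assoc (U.map _), hP,
    Matrix.mul_assoc, ← Matrix.mul_assoc S, ← Matrix.mul_assoc S, hSYS]

theorem IsLSUFactorization.mul_pinv_mul_self (h : IsLSUFactorization A L U M W S d) :
    A.map (algebraMap R F) * pinv W S M (d (Fin.last r)) * A.map (algebraMap R F) =
      A.map (algebraMap R F) := by
  conv_lhs =>
    arg 2
    rw [← h.factor]
  rw [← Matrix.mul_assoc, ← Matrix.mul_assoc, h.mul_pinv_mul_lower,
    Matrix.mul_assoc (L.map _), unitMap_mul_transpose_mul h.weightedPerm, h.factor]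

theorem IsLSUFactorization.pinv_mul_pinv (h : IsLSUFactorization A L U M W S d) :
    pinv W S M (d (Fin.last r)) * A.map (algebraMap R F) * pinv W S M (d (Fin.last r)) =
      pinv (F := F) W S M (d (Fin.last r)) := by
  obtain ⟨Y, -, hYS, hSYS, hP⟩ := h.exists_inverse_ext
  refine h.isUnit_upper.mul_left_cancel (h.isUnit_lower.mul_right_cancel ?_)
  rw [← Matrix.mul_assoc, h.upper_mul_pinv_mul, Matrix.mul_assoc, Matrix.mul_assoc,
    ← Matrix.mul_assoc (U.map _), hP, ← hYS, Matrix.mul_assoc Y S, ← Matrix.mul_assoc S,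
    ← Matrix.mul_assoc S, hSYS, Matrix.mul_assoc]

theorem IsLSUFactorization.pinv_eq_inverse (h : IsLSUFactorization A L U M W S d)
    (hA : IsUnit (A.map (algebraMap R F))) :
    A.map (algebraMap R F) * pinv W S M (d (Fin.last r)) = 1 ∧
      pinv W S M (d (Fin.last r)) * A.map (algebraMap R F) = 1 := by
  have h1 : A.map (algebraMap R F) * pinv W S M (d (Fin.last r)) = 1 :=
    hA.mul_right_cancel (by rw [h.mul_pinv_mul_self, Matrix.one_mul])
  exact ⟨h1, mul_eq_one_comm.1 h1⟩

end Pseudoinverse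

section AllOnes

variable {m : ℕ} {R F : Type*} [CommRing R] [IsDomain R] [Field F] [Algebra R F]
  [IsFractionRing R F]

/-- The matrix with all entries `1`. -/
def allOnes (m : ℕ) (R : Type*) [CommRing R] : Matrix (Fin m) (Fin m) R := of fun _ _ => 1

theorem allOnes_map (m : ℕ) (R F : Type*) [CommRing R] [Field F] [Algebra R F] :
    (allOnes m R).map (algebraMap R F) = allOnes m F := by
  ext
  simp [allOnes]

theorem rank_allOnes : (allOnes (m + 1) F).rank = 1 := by
  have h : allOnes (m + 1) F = vecMulVec 1 1 := by
    ext
    simp [allOnes, vecMulVec_apply]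
  refine le_antisymm (h ▸ rank_vecMulVec_le _ _) (Nat.one_le_iff_ne_zero.2 fun h0 => ?_)
  have hr := LinearMap.range_eq_bot.1 (Submodule.finrank_eq_zero.1 h0)
  have := congrFun (LinearMap.congr_fun hr (Pi.single 0 1)) 0
  simp [allOnes] at this

theorem not_isUnit_allOnes : ¬ IsUnit (allOnes (m + 2) F) := fun h => by
  have := rank_of_isUnit _ h
  rw [rank_allOnes, Fintype.card_fin] at this
  omega

/-- The unit matrix, with its first column replaced by ones. -/
def firstColOnes (m : ℕ) (R : Type*) [CommRing R] : Matrix (Fin (m + 1)) (Fin (m + 1)) R :=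
  of fun i j => if j = 0 ∨ i = j then 1 else 0

/-- The inverse of `firstColOnes`. -/
def firstColOnesInv (m : ℕ) (R : Type*) [CommRing R] : Matrix (Fin (m + 1)) (Fin (m + 1)) R :=
  of fun i j => if i = j then 1 else if j = 0 then -1 else 0

theorem firstColOnes_mul_inv : firstColOnes m F * firstColOnesInv m F = 1 := by
  ext i j
  rw [mul_apply, Fin.sum_univ_succ]
  refine Fin.cases ?_ (fun i => ?_) i <;> refine Fin.cases ?_ (fun j => ?_) j <;>
    simp [firstColOnes, firstColOnesInv, one_apply, Fin.succ_ne_zero, (Fin.succ_ne_zero _).symm]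

theorem firstColOnes_map (m : ℕ) (R F : Type*) [CommRing R] [Field F] [Algebra R F] :
    (firstColOnes m R).map (algebraMap R F) = firstColOnes m F := by
  ext
  simp [firstColOnes, apply_ite (algebraMap R F)]

theorem firstColOnesInv_map (m : ℕ) (R F : Type*) [CommRing R] [Field F] [Algebra R F] :
    (firstColOnesInv m R).map (algebraMap R F) = firstColOnesInv m F := by
  ext
  simp [firstColOnesInv, apply_ite (algebraMap R F)]

theorem isWeightedPermutation_single :
    IsWeightedPermutation (Matrix.single (0 : Fin (m + 1)) (0 : Fin (m + 1)) (1 : F)) := by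
  constructor <;> simp +contextual [single_apply]

theorem zeroRow_single_iff (i : Fin (m + 1)) :
    ZeroRow (Matrix.single (0 : Fin (m + 1)) (0 : Fin (m + 1)) (1 : F)) i ↔ i ≠ 0 := by
  refine ⟨fun h hi => ?_, fun h j => by simp [h.symm]⟩
  have := h 0
  simp [hi] at this

theorem zeroCol_single_iff (j : Fin (m + 1)) :
    ZeroCol (Matrix.single (0 : Fin (m + 1)) (0 : Fin (m + 1)) (1 : F)) j ↔ j ≠ 0 := by
  refine ⟨fun h hj => ?_, fun h i => by simp [h.symm]⟩
  have := h 0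
  simp [hj] at this

theorem ncard_lt_and_ne_zero (i : Fin (m + 1)) :
    {i' : Fin (m + 1) | i' < i ∧ i' ≠ 0}.ncard = (i : ℕ) - 1 := by
  have : {i' : Fin (m + 1) | i' < i ∧ i' ≠ 0} = ↑(Finset.Ioo 0 i) := by
    ext i'
    simp [Fin.pos_iff_ne_zero, and_comm]
  rw [this, Set.ncard_coe_finset, Fin.card_Ioo]
  simp

theorem ext_single : ext (Matrix.single (0 : Fin (m + 1)) (0 : Fin (m + 1)) (1 : F)) = 1 := by
  ext i j
  simp only [ext, compl, Matrix.add_apply, of_apply, zeroRow_single_iff, zeroCol_single_iff,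
    ncard_lt_and_ne_zero]
  refine Fin.cases ?_ (fun i => ?_) i <;> refine Fin.cases ?_ (fun j => ?_) j <;>
    simp [one_apply, (Fin.succ_ne_zero _).symm, Fin.val_inj]

theorem unitMap_single :
    unitMap (Matrix.single (0 : Fin (m + 1)) (0 : Fin (m + 1)) (1 : F)) = Matrix.single 0 0 1 := by
  ext i j
  by_cases h : 0 = i ∧ 0 = j <;> simp [unitMap, single_apply, h]

theorem firstColOnes_mul_single_mul_transpose :
    firstColOnes m F * Matrix.single 0 0 1 * (firstColOnes m F)ᵀ = allOnes (m + 1) F := by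
  ext i j
  rw [mul_apply, Finset.sum_eq_single 0]
  · simp [firstColOnes, allOnes]
  · intro k _ hk
    simp [mul_single_apply_of_ne, hk]
  · simp

theorem firstColOnes_mul_one_sub_single :
    firstColOnes m F * (1 - Matrix.single 0 0 1) = 1 - Matrix.single 0 0 1 := by
  ext i j
  refine Fin.cases ?_ (fun j => ?_) j
  · rw [Matrix.mul_sub, Matrix.mul_one]
    refine Fin.cases ?_ (fun i => ?_) i <;>
      simp [firstColOnes, one_apply, (Fin.succ_ne_zero _).symm]
  · rw [Matrix.mul_sub, Matrix.mul_one]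
    simp [firstColOnes, one_apply, (Fin.succ_ne_zero _).symm,
      mul_single_apply_of_ne]

theorem isLSUFactorization_allOnes : IsLSUFactorization (r := 1) (allOnes (m + 1) R)
    (firstColOnes m R) (firstColOnes m R)ᵀ (firstColOnesInv m R) (firstColOnesInv m R)ᵀ
    (Matrix.single 0 0 (1 : F)) (fun _ => 1) where
  rank_eq := by rw [allOnes_map, rank_allOnes]
  minors := by
    refine ⟨fun _ _ => 0, fun _ _ => 0, fun k => ?_, fun k l hkl => ?_, fun k => ⟨?_, one_ne_zero⟩⟩
    · have : Subsingleton (Fin (k : ℕ)) := Fin.subsingleton_iff_le_one.2 (Nat.lt_succ_iff.1 k.2)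
      exact ⟨Function.injective_of_subsingleton _, Function.injective_of_subsingleton _⟩
    · have (x : Fin (k : ℕ)) :
          (0 : Fin (m + 1)) ∈ Set.range fun _ : Fin (l : ℕ) => (0 : Fin (m + 1)) :=
        ⟨Fin.castLE hkl x, rfl⟩
      constructor <;> rintro _ ⟨x, rfl⟩ <;> exact this x
    · fin_cases k
      · exact (det_fin_zero (R := R)).symm
      · exact (det_fin_one ((allOnes (m + 1) R).submatrix
          (fun _ : Fin 1 => 0) fun _ : Fin 1 => 0)).symm
  lower i j hij := by
    have hij : i < j := hij
    simp [firstColOnes, hij.ne, (lt_of_le_of_lt (Fin.zero_le _) hij).ne']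
  upper i j hij := by
    have hij : j < i := hij
    simp [firstColOnes, hij.ne, (lt_of_le_of_lt (Fin.zero_le _) hij).ne']
  weightedPerm := isWeightedPermutation_single
  entries := by
    refine ⟨fun _ => (0, 0), Function.injective_of_subsingleton _, fun i j => ?_, fun k => ?_⟩
    · simp [single_apply, eq_comm]
    · simp
  factor := by
    rw [transpose_map, firstColOnes_map, allOnes_map, firstColOnes_mul_single_mul_transpose]
  left_inv := by
    rw [firstColOnes_map, firstColOnesInv_map, hat, ext_single]
    simp [firstColOnes_mul_inv]
  right_inv := by
    rw [transpose_map, transpose_map, firstColOnes_map, firstColOnesInv_map, hat, ext_single]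
    simp [← transpose_mul, firstColOnes_mul_inv]
  lower_compl := by
    rw [unitMap_single, firstColOnes_map]
    simp [firstColOnes_mul_one_sub_single]
  upper_compl := by
    rw [unitMap_single, transpose_map, firstColOnes_map]
    simpa using congrArg Matrix.transpose (firstColOnes_mul_one_sub_single (m := m) (F := F))

variable {r : ℕ} {L U M W : Matrix (Fin (m + 1)) (Fin (m + 1)) R}
  {S : Matrix (Fin (m + 1)) (Fin (m + 1)) F} {d : Fin (r + 1) → R}

theorem IsLSUFactorization.exists_ne_zero_of_allOnes
    (h : IsLSUFactorization (allOnes (m + 1) R) L U M W S d) (i j : Fin (m + 1)) :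
    ∃ k l, L i k ≠ 0 ∧ S k l ≠ 0 ∧ U l j ≠ 0 := by
  have hf := congrFun (congrFun h.factor i) j
  rw [allOnes_map, mul_apply] at hf
  have h1 : ∑ l, (L.map (algebraMap R F) * S) i l * U.map (algebraMap R F) l j ≠ 0 := by
    rw [hf]
    simp [allOnes]
  obtain ⟨l, -, hl⟩ := Finset.exists_ne_zero_of_sum_ne_zero h1
  have h2 := left_ne_zero_of_mul hl
  rw [mul_apply] at h2
  obtain ⟨k, -, hk⟩ := Finset.exists_ne_zero_of_sum_ne_zero h2
  refine ⟨k, l, fun h0 => hk ?_, right_ne_zero_of_mul hk, fun h0 => hl ?_⟩ <;> simp [h0]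

/-- Every LSU factorization of the matrix of ones has its only weight in the top left corner. -/
theorem IsLSUFactorization.allOnes_apply_ne_zero_iff
    (h : IsLSUFactorization (allOnes (m + 1) R) L U M W S d) (i j : Fin (m + 1)) :
    S i j ≠ 0 ↔ i = 0 ∧ j = 0 := by
  have hr := h.rank_eq
  rw [allOnes_map, rank_allOnes] at hr
  subst hr
  obtain ⟨e, -, he, -⟩ := h.entries
  have hS : ∀ i j, S i j ≠ 0 ↔ i = (e 0).1 ∧ j = (e 0).2 := fun i j => by
    rw [he, Set.mem_range]
    constructor
    · rintro ⟨k, hk⟩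
      rw [Subsingleton.elim 0 k, hk]
      exact ⟨rfl, rfl⟩
    · rintro ⟨rfl, rfl⟩
      exact ⟨0, rfl⟩
  obtain ⟨k, l, hL, hkl, hU⟩ := h.exists_ne_zero_of_allOnes 0 0
  have hk : k = 0 := by
    by_contra hne
    exact hL (h.lower (Fin.pos_of_ne_zero hne))
  have hl : l = 0 := by
    by_contra hne
    exact hU (h.upper (Fin.pos_of_ne_zero hne))
  obtain ⟨h2, h3⟩ := (hS _ _).1 hkl
  rw [hS, ← h2, ← h3, hk, hl]

theorem IsLSUFactorization.allOnes_unitMap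
    (h : IsLSUFactorization (allOnes (m + 1) R) L U M W S d) :
    unitMap S = Matrix.single 0 0 1 := by
  ext i j
  have hS : S i j = 0 ↔ ¬(0 = i ∧ 0 = j) := by
    rw [← not_iff_not, not_not, ← ne_eq, h.allOnes_apply_ne_zero_iff, eq_comm, eq_comm (a := j)]
  by_cases h0 : 0 = i ∧ 0 = j <;> simp [unitMap, single_apply, hS, h0]

theorem IsLSUFactorization.allOnes_pinv_mul_transpose_ne (hm : m ≠ 0)
    (h : IsLSUFactorization (allOnes (m + 1) R) L U M W S d) :
    (pinv W S M (d (Fin.last r)) * (allOnes (m + 1) R).map (algebraMap R F))ᵀ ≠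
      pinv W S M (d (Fin.last r)) * (allOnes (m + 1) R).map (algebraMap R F) := by
  have hQ := h.upper_mul_pinv_mul
  have hU := h.upper_compl
  rw [h.allOnes_unitMap] at hQ hU
  simp only [transpose_single, single_mul_single_same, mul_one] at hQ hU
  generalize pinv W S M (d (Fin.last r)) * (allOnes (m + 1) R).map (algebraMap R F) = Q at *
  intro hsymm
  have hQ0 : (1 - Matrix.single 0 0 1) * Q = 0 := by
    calc _ = (1 - Matrix.single 0 0 1) * (U.map (algebraMap R F) * Q) := by
          rw [← Matrix.mul_assoc, hU]
      _ = 0 := by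
          rw [hQ, ← Matrix.mul_assoc, Matrix.sub_mul, single_mul_single_same]
          simp
  have hlast : Fin.last m ≠ 0 := by simpa [Fin.ext_iff] using hm
  have hrow : ∀ i ≠ 0, ∀ j, Q i j = 0 := fun i hi j => by
    have := congrFun (congrFun hQ0 i) j
    simpa [Matrix.sub_mul, single_mul_apply_of_ne, hi] using this
  obtain ⟨k, l, -, hkl, hne⟩ := h.exists_ne_zero_of_allOnes 0 (Fin.last m)
  rw [((h.allOnes_apply_ne_zero_iff k l).1 hkl).2] at hne
  refine hne (IsFractionRing.injective R F ?_)
  have hentry := congrFun (congrFun hQ 0) (Fin.last m)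
  rw [mul_apply, Finset.sum_eq_zero] at hentry
  · simpa using hentry.symm
  · intro k _
    rw [← hsymm, transpose_apply, hrow _ hlast, mul_zero]

theorem IsLSUFactorization.allOnes_mul_pinv_transpose_ne (hm : m ≠ 0)
    (h : IsLSUFactorization (allOnes (m + 1) R) L U M W S d) :
    ((allOnes (m + 1) R).map (algebraMap R F) * pinv W S M (d (Fin.last r)))ᵀ ≠
      (allOnes (m + 1) R).map (algebraMap R F) * pinv W S M (d (Fin.last r)) := by
  have hQ := h.mul_pinv_mul_lower
  have hL := h.lower_compl
  rw [h.allOnes_unitMap] at hQ hL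
  simp only [transpose_single, single_mul_single_same, mul_one] at hQ hL
  generalize (allOnes (m + 1) R).map (algebraMap R F) * pinv W S M (d (Fin.last r)) = Q at *
  intro hsymm
  have hQ0 : Q * (1 - Matrix.single 0 0 1) = 0 := by
    calc _ = Q * L.map (algebraMap R F) * (1 - Matrix.single 0 0 1) := by
          rw [Matrix.mul_assoc, hL]
      _ = 0 := by
          rw [hQ, Matrix.mul_assoc, Matrix.mul_sub, single_mul_single_same]
          simp
  have hlast : Fin.last m ≠ 0 := by simpa [Fin.ext_iff] using hm
  have hcol : ∀ j ≠ 0, ∀ i, Q i j = 0 := fun j hj i => by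
    have := congrFun (congrFun hQ0 i) j
    simpa [Matrix.mul_sub, mul_single_apply_of_ne, hj] using this
  obtain ⟨k, l, hne, hkl, -⟩ := h.exists_ne_zero_of_allOnes (Fin.last m) 0
  rw [((h.allOnes_apply_ne_zero_iff k l).1 hkl).1] at hne
  refine hne (IsFractionRing.injective R F ?_)
  have hentry := congrFun (congrFun hQ (Fin.last m)) 0
  rw [mul_apply, Finset.sum_eq_zero] at hentry
  · simpa using hentry.symm
  · intro k _
    rw [← hsymm, transpose_apply, hcol _ hlast, zero_mul]

end AllOnes

end LSU

theorem mainTheorem5 (R : Type*) (F : Type*) [CommRing R] [IsDomain R] [Field F] [Algebra R F]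
    [IsFractionRing R F] :
    -- `P` is the inverse of an invertible `A`, and a pseudoinverse of any `A`
    (∀ (n r : ℕ) (A L U M W : Matrix (Fin n) (Fin n) R) (S : Matrix (Fin n) (Fin n) F)
      (d : Fin (r + 1) → R), LSU.IsLSUFactorization A L U M W S d →
      (IsUnit (A.map (algebraMap R F)) →
        A.map (algebraMap R F) * LSU.pinv W S M (d (Fin.last r)) = 1 ∧
        LSU.pinv W S M (d (Fin.last r)) * A.map (algebraMap R F) = 1) ∧
      A.map (algebraMap R F) * LSU.pinv W S M (d (Fin.last r)) * A.map (algebraMap R F) =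
        A.map (algebraMap R F) ∧
      LSU.pinv W S M (d (Fin.last r)) * A.map (algebraMap R F) *
          LSU.pinv W S M (d (Fin.last r)) = LSU.pinv W S M (d (Fin.last r))) ∧
    -- in every size `n ≥ 2` there is a singular `A`, with an LSU factorization, for which `P A` and
    -- `A P` are not symmetric, whatever LSU factorization is used
    (∀ n : ℕ, 2 ≤ n → ∃ A : Matrix (Fin n) (Fin n) R, ¬ IsUnit (A.map (algebraMap R F)) ∧
      (∃ (r : ℕ) (L U M W : Matrix (Fin n) (Fin n) R) (S : Matrix (Fin n) (Fin n) F)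
        (d : Fin (r + 1) → R), LSU.IsLSUFactorization A L U M W S d) ∧
      ∀ (r : ℕ) (L U M W : Matrix (Fin n) (Fin n) R) (S : Matrix (Fin n) (Fin n) F)
        (d : Fin (r + 1) → R), LSU.IsLSUFactorization A L U M W S d →
        (LSU.pinv W S M (d (Fin.last r)) * A.map (algebraMap R F)).transpose ≠
          LSU.pinv W S M (d (Fin.last r)) * A.map (algebraMap R F) ∧
        (A.map (algebraMap R F) * LSU.pinv W S M (d (Fin.last r))).transpose ≠
          A.map (algebraMap R F) * LSU.pinv W S M (d (Fin.last r)) ∧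
        ¬ LSU.IsMoorePenroseInverse (A.map (algebraMap R F))
          (LSU.pinv W S M (d (Fin.last r)))) := by
  refine ⟨fun n r A L U M W S d h => ⟨h.pinv_eq_inverse, h.mul_pinv_mul_self, h.pinv_mul_pinv⟩,
    fun n hn => ?_⟩
  obtain ⟨m, rfl⟩ := Nat.exists_eq_add_of_le' hn
  refine ⟨LSU.allOnes (m + 2) R, ?_, ⟨1, _, _, _, _, _, _, LSU.isLSUFactorization_allOnes⟩,
    fun r L U M W S d h => ⟨h.allOnes_pinv_mul_transpose_ne m.succ_ne_zero,
      h.allOnes_mul_pinv_transpose_ne m.succ_ne_zero,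
      fun hP => h.allOnes_pinv_mul_transpose_ne m.succ_ne_zero hP.2.2.1⟩⟩
  rw [LSU.allOnes_map]
  exact LSU.not_isUnit_allOnes
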